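/- There is an absolute constant $\gamma>0$ and, for every $\theta>0$, a constant $\gamma_1(\theta)>0$ depending only on $\theta$, such that the following holds. Let $m,n$ be positive integers and let $w_{jk}$, $1\le j\le m$, $1\le k\le n$, be jointly Gaussian (possibly degenerate) real random variables on a probability space such that $\mathbf E\,w_{jk}=0$ and $$\mathbf E\,w_{jk}^2\le\frac{\theta}{m+n}\quad\text{for all } j,k,$$ $$\left|\mathbf E\,w_{j_1k_1}w_{j_2k_2}\right|\le\frac{\theta}{(m+n)^2}\quad\text{whenever } j_1\ne j_2\text{ and }k_1\ne k_2.$$ Let $W=\sum_{j=1}^m\sum_{k=1}^n w_{jk}^4$. Then $W$ is square-integrable and 1. $\mathbf E\,W\le\gamma\theta^2$; 2. $\operatorname{var}W\le\dfrac{\gamma\theta^4}{m+n}$; 3. $\mathbf P\{W>\gamma\theta^2+1\}\le\exp\left\{-(m+n)^{1/5}\right\}$ provided $m+n\ge\gamma_1(\theta)$. -/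

import Mathlib

open MeasureTheory ProbabilityTheory

/-- The random variable `W = ∑_{j,k} w_{jk}⁴` attached to an `m × n` array of random variables. -/
def quarticSum {Ω : Type*} {m n : ℕ} (w : Fin m → Fin n → Ω → ℝ) : Ω → ℝ :=
  fun ω => ∑ j, ∑ k, w j k ω ^ 4

/-- An `m × n` array of random variables is (jointly) Gaussian, centered, with variances at most
`θ / (m + n)`, and with covariances at most `θ / (m + n)²` in absolute value for entries that lie
in different rows and in different columns. Degenerate Gaussian laws are allowed. -/
structure IsWeaklyCorrelatedGaussianArray {Ω : Type*} [MeasurableSpace Ω] {m n : ℕ}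
    (w : Fin m → Fin n → Ω → ℝ) (θ : ℝ) (P : Measure Ω) : Prop where
  gaussian : HasGaussianLaw (fun ω (p : Fin m × Fin n) => w p.1 p.2 ω) P
  centered : ∀ j k, ∫ ω, w j k ω ∂P = 0
  second_moment_le : ∀ j k, ∫ ω, w j k ω ^ 2 ∂P ≤ θ / ((m : ℝ) + n)
  abs_cov_le : ∀ j₁ j₂ k₁ k₂, j₁ ≠ j₂ → k₁ ≠ k₂ →
    |∫ ω, w j₁ k₁ ω * w j₂ k₂ ω ∂P| ≤ θ / ((m : ℝ) + n) ^ 2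

/-! Put `N = m + n` and regard the array as a centered Gaussian vector `x`. All covariances are at
most `A = θ / N`, and each row of the covariance matrix has absolute sum at most `B = 2θ`. The mean
of `W = ∑ x_a⁴` follows from Gaussian moments, as there are at most `N² / 4` entries.

Both fluctuation bounds come from the Maurey–Pisier inequality `lintegral_convex_sub_le_fderiv`: two
independent copies are joined by a rotation, along which position and velocity remain such a pair.
The square gives a Poincaré inequality and the exponential gives concentration, each in terms of the
covariance form evaluated at the gradient.

For the variance, the gradient `4 x_a³` and the row sums give `O(A³ B N²) = O(θ⁴ / N)`. For the
tail, `W` is replaced by `(1 + W)^(1/4)`, whose gradient has covariance form at most `3θ / (2√N)`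
everywhere (`quadraticForm_cube_le`). Hence a tail `exp (C - d N^(1/4))`, which beats `exp
(-N^(1/5))`. -/

/-! ### Rotation interpolation between independent Gaussian copies. -/

theorem sub_eq_intervalIntegral_rotation {E : Type*} [NormedAddCommGroup E] [NormedSpace ℝ E]
    {f : E → ℝ} (hf : ContDiff ℝ 1 f) (p : E × E) :
    f p.2 - f p.1 = ∫ s in (0 : ℝ)..1, Real.pi / 2 *
      fderiv ℝ f (ContinuousLinearMap.rotation (Real.pi / 2 * s) p).1
        (ContinuousLinearMap.rotation (Real.pi / 2 * s) p).2 := by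
  simp only [ContinuousLinearMap.rotation_apply]
  have hd : ∀ s ∈ Set.uIcc (0 : ℝ) 1, HasDerivAt
      (fun s => f (Real.cos (Real.pi / 2 * s) • p.1 + Real.sin (Real.pi / 2 * s) • p.2))
      (Real.pi / 2 * fderiv ℝ f
        (Real.cos (Real.pi / 2 * s) • p.1 + Real.sin (Real.pi / 2 * s) • p.2)
        (-Real.sin (Real.pi / 2 * s) • p.1 + Real.cos (Real.pi / 2 * s) • p.2)) s := by
    intro s _
    have hlin : HasDerivAt (fun s : ℝ => Real.pi / 2 * s) (Real.pi / 2) s := by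
      simpa using (hasDerivAt_id s).const_mul (Real.pi / 2)
    have h1 := (hlin.cos.smul_const p.1).add (hlin.sin.smul_const p.2)
    have h2 := ((hf.differentiable one_ne_zero) (Real.cos (Real.pi / 2 * s) • p.1 +
      Real.sin (Real.pi / 2 * s) • p.2)).hasFDerivAt.comp_hasDerivAt s h1
    refine h2.congr_deriv ?_
    generalize fderiv ℝ f _ = L
    simp only [map_add, map_smul, smul_eq_mul]
    ring
  have hfd := hf.continuous_fderiv one_ne_zero
  have hc : Continuous fun s : ℝ => Real.pi / 2 * fderiv ℝ f
        (Real.cos (Real.pi / 2 * s) • p.1 + Real.sin (Real.pi / 2 * s) • p.2)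
        (-Real.sin (Real.pi / 2 * s) • p.1 + Real.cos (Real.pi / 2 * s) • p.2) :=
    continuous_const.mul ((hfd.comp (by fun_prop)).clm_apply (by fun_prop))
  rw [intervalIntegral.integral_eq_sub_of_hasDerivAt hd (hc.intervalIntegrable 0 1)]
  simp

/-- The **Maurey–Pisier inequality**: a convex functional of the increment `f y - f x` between two
independent copies of a centered Gaussian vector is controlled by that of its differential. -/
theorem lintegral_convex_sub_le_fderiv {E : Type*} [NormedAddCommGroup E] [NormedSpace ℝ E]
    [CompleteSpace E] [SecondCountableTopology E] [MeasurableSpace E] [BorelSpace E]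
    {μ : Measure E} [IsGaussian μ] (hμ : μ[id] = 0) {f : E → ℝ} (hf : ContDiff ℝ 1 f)
    {Ψ : ℝ → ℝ} (hΨ : ConvexOn ℝ Set.univ Ψ) (hΨc : Continuous Ψ) (hΨ0 : ∀ x, 0 ≤ Ψ x) :
    ∫⁻ p, ENNReal.ofReal (Ψ (f p.2 - f p.1)) ∂(μ.prod μ) ≤
      ∫⁻ p, ENNReal.ofReal (Ψ (Real.pi / 2 * fderiv ℝ f p.1 p.2)) ∂(μ.prod μ) := by
  set G : E × E → ℝ := fun q => fderiv ℝ f q.1 q.2 with hG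
  have hGc : Continuous G :=
    ((hf.continuous_fderiv one_ne_zero).comp continuous_fst).clm_apply continuous_snd
  set R : ℝ → E × E → E × E :=
    fun s => ContinuousLinearMap.rotation (Real.pi / 2 * s) with hR
  have hRc : Continuous fun z : (E × E) × ℝ => R z.2 z.1 := by
    simp only [hR, ContinuousLinearMap.rotation_apply]
    fun_prop
  have hRp : ∀ p : E × E, Continuous fun s => R s p := fun p => by
    simp only [hR, ContinuousLinearMap.rotation_apply]
    fun_prop
  set ν : Measure ℝ := volume.restrict (Set.Ioc 0 1) with hν
  have hνp : IsProbabilityMeasure ν := ⟨by simp [hν]⟩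
  have hint : ∀ {h : ℝ → ℝ}, Continuous h → Integrable h ν := fun hh =>
    (hh.intervalIntegrable 0 1).1
  have hinc : ∀ p : E × E, f p.2 - f p.1 = ∫ s, Real.pi / 2 * G (R s p) ∂ν := fun p => by
    rw [sub_eq_intervalIntegral_rotation hf, intervalIntegral.integral_of_le zero_le_one]
  have hjensen : ∀ p : E × E, ENNReal.ofReal (Ψ (f p.2 - f p.1)) ≤
      ∫⁻ s, ENNReal.ofReal (Ψ (Real.pi / 2 * G (R s p))) ∂ν := by
    intro p
    have hc : Continuous fun s => Real.pi / 2 * G (R s p) :=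
      continuous_const.mul (hGc.comp (hRp p))
    rw [← ofReal_integral_eq_lintegral_ofReal
      (f := fun s => Ψ (Real.pi / 2 * G (R s p))) (hint (hΨc.comp hc))
      (Filter.Eventually.of_forall fun _ => hΨ0 _), hinc]
    exact ENNReal.ofReal_le_ofReal (hΨ.map_integral_le hΨc.continuousOn isClosed_univ
      (by simp) (hint hc) (hint (hΨc.comp hc)))
  have hmeas : Measurable fun q : E × E => ENNReal.ofReal (Ψ (Real.pi / 2 * G q)) :=
    (hΨc.comp (continuous_const.mul hGc)).measurable.ennreal_ofReal
  calc _ ≤ ∫⁻ p, ∫⁻ s, ENNReal.ofReal (Ψ (Real.pi / 2 * G (R s p))) ∂ν ∂(μ.prod μ) :=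
        lintegral_mono hjensen
    _ = ∫⁻ s, ∫⁻ p, ENNReal.ofReal (Ψ (Real.pi / 2 * G (R s p))) ∂(μ.prod μ) ∂ν :=
        lintegral_lintegral_swap (hmeas.comp hRc.measurable).aemeasurable
    _ = ∫⁻ _, ∫⁻ p, ENNReal.ofReal (Ψ (Real.pi / 2 * G p)) ∂(μ.prod μ) ∂ν := by
        refine lintegral_congr fun s => ?_
        -- Rotation invariance of `μ.prod μ` removes the dependence on `s`.
        conv_rhs => rw [← IsGaussian.map_rotation_eq_self hμ (Real.pi / 2 * s)]
        rw [lintegral_map hmeas (ContinuousLinearMap.continuous _).measurable]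
    _ = _ := by simp [hG]

/-! ### Gaussian exponential and polynomial moments. -/

theorem lintegral_exp_dual_eq {E : Type*} [NormedAddCommGroup E] [NormedSpace ℝ E]
    [CompleteSpace E] [SecondCountableTopology E] [MeasurableSpace E] [BorelSpace E]
    {μ : Measure E} [IsGaussian μ] (hμ : μ[id] = 0) (L : StrongDual ℝ E) :
    ∫⁻ x, ENNReal.ofReal (Real.exp (L x)) ∂μ =
      ENNReal.ofReal (Real.exp ((∫ x, L x ^ 2 ∂μ) / 2)) := by
  have h0 : μ[L] = 0 := by
    rw [IsGaussian.integral_dual]; simp only [id] at hμ; simp [hμ]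
  have hmap := IsGaussian.map_eq_gaussianReal (μ := μ) L
  have hmgf := mgf_gaussianReal hmap 1
  have hint : Integrable (fun x => Real.exp (L x)) μ := by
    have := (mgf_pos_iff (X := L) (μ := μ) (t := 1)).1 (by rw [hmgf]; exact Real.exp_pos _)
    simpa using this
  rw [← ofReal_integral_eq_lintegral_ofReal hint
    (Filter.Eventually.of_forall fun _ => (Real.exp_pos _).le)]
  rw [mgf] at hmgf
  simp only [one_mul, h0] at hmgf
  rw [hmgf, Real.coe_toNNReal _ (variance_nonneg _ _),
    variance_of_integral_eq_zero (L.continuous.aemeasurable) h0]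
  simp

/-- The crude constant comes from `x^(2k) / (2k)! ≤ e^x + e^(-x)`, whose standard Gaussian mean is
`2 e^(1/2) ≤ 4`; scaling gives general `v`. -/
theorem integral_even_pow_gaussianReal_le (v : NNReal) (k : ℕ) :
    ∫ x, x ^ (2 * k) ∂(gaussianReal 0 v) ≤ 4 * (2 * k).factorial * (v : ℝ) ^ k := by
  have hstd : ∫ x, x ^ (2 * k) ∂(gaussianReal 0 1) ≤ 4 * (2 * k).factorial := by
    have hi : ∀ t : ℝ, Integrable (fun x => Real.exp (t * x)) (gaussianReal 0 1) :=
      fun t => integrable_exp_mul_gaussianReal t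
    have hm : ∀ t : ℝ, ∫ x, Real.exp (t * x) ∂(gaussianReal 0 1) = Real.exp (t ^ 2 / 2) := by
      intro t
      have := congrFun (mgf_fun_id_gaussianReal (μ := 0) (v := 1)) t
      simpa [mgf] using this
    have hpt : ∀ x : ℝ, x ^ (2 * k) ≤
        (2 * k).factorial * (Real.exp (1 * x) + Real.exp (-1 * x)) := by
      intro x
      have h1 := Real.pow_div_factorial_le_exp |x| (abs_nonneg x) (2 * k)
      rw [(even_two_mul k).pow_abs, div_le_iff₀ (by positivity)] at h1
      have h2 : Real.exp |x| ≤ Real.exp (1 * x) + Real.exp (-1 * x) := by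
        rcases abs_cases x with h | h <;> rw [h.1] <;> simp [Real.exp_nonneg]
      calc _ ≤ _ := h1
        _ ≤ _ := by rw [mul_comm]; gcongr
    calc _ ≤ ∫ x, (2 * k).factorial * (Real.exp (1 * x) + Real.exp (-1 * x))
          ∂(gaussianReal 0 1) :=
          integral_mono_of_nonneg (Filter.Eventually.of_forall fun x => (even_two_mul k).pow_nonneg x)
            (((hi _).add (hi _)).const_mul _) (Filter.Eventually.of_forall hpt)
      _ = (2 * k).factorial * (2 * Real.exp (1 / 2)) := by
          rw [integral_const_mul, integral_add (hi _) (hi _), hm, hm, neg_one_sq, one_pow]; ring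
      _ ≤ _ := by
          have : Real.exp (1 / 2) ≤ 2 := by
            have h := Real.exp_one_lt_d9
            have h2 : Real.exp (1 / 2) ^ 2 = Real.exp 1 := by
              rw [← Real.exp_nat_mul]; norm_num
            nlinarith [Real.exp_pos (1 / 2 : ℝ)]
          nlinarith [(Nat.cast_nonneg (2 * k).factorial : (0 : ℝ) ≤ _)]
  have hscale : gaussianReal 0 v = (gaussianReal 0 1).map (Real.sqrt v * ·) := by
    rw [gaussianReal_map_const_mul]
    congr 1
    · simp
    · ext; simp
  rw [hscale, integral_map (by fun_prop) (by fun_prop)]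
  simp_rw [mul_pow]
  rw [integral_const_mul, pow_mul (Real.sqrt v), Real.sq_sqrt v.coe_nonneg, mul_comm]
  gcongr

/-! ### Poincaré and concentration inequalities. -/

theorem integrable_dual_sq {E : Type*} [NormedAddCommGroup E] [NormedSpace ℝ E]
    [MeasurableSpace E] [BorelSpace E] (μ : Measure E) [IsGaussian μ] (L : StrongDual ℝ E) :
    Integrable (fun x => L x ^ 2) μ :=
  (IsGaussian.memLp_dual μ L 2 (by simp)).integrable_sq

/-- A **Gaussian Poincaré inequality** (with a non-optimal constant). -/
theorem variance_le_of_fderiv {E : Type*} [NormedAddCommGroup E] [NormedSpace ℝ E]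
    [CompleteSpace E] [SecondCountableTopology E] [MeasurableSpace E] [BorelSpace E]
    {μ : Measure E} [IsGaussian μ] (hμ : μ[id] = 0) {f : E → ℝ} (hf : ContDiff ℝ 1 f)
    (hf2 : MemLp f 2 μ) {V : E → ℝ} (hVi : Integrable V μ)
    (hV : ∀ x, ∫ y, (fderiv ℝ f x y) ^ 2 ∂μ ≤ V x) :
    variance f μ ≤ (Real.pi / 2) ^ 2 * ∫ x, V x ∂μ := by
  have hV0 : ∀ x, 0 ≤ V x := fun x => (integral_nonneg fun y => sq_nonneg _).trans (hV x)
  have hmp := lintegral_convex_sub_le_fderiv hμ hf (Ψ := fun x => x ^ 2)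
    (Even.convexOn_pow even_two) (by fun_prop) (fun x => sq_nonneg x)
  have hfc := hf.continuous
  have hGc : Continuous fun q : E × E => fderiv ℝ f q.1 q.2 :=
    ((hf.continuous_fderiv one_ne_zero).comp continuous_fst).clm_apply continuous_snd
  rw [lintegral_prod _ (by fun_prop), lintegral_prod _ (by fun_prop)] at hmp
  have hlow : ENNReal.ofReal (variance f μ) ≤
      ∫⁻ x, ∫⁻ y, ENNReal.ofReal ((f y - f x) ^ 2) ∂μ ∂μ := by
    have : ENNReal.ofReal (variance f μ) = ∫⁻ _, ENNReal.ofReal (variance f μ) ∂μ := by simp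
    rw [this]
    refine lintegral_mono fun x => ?_
    have hd : MemLp (fun y => f y - f x) 2 μ := hf2.sub (memLp_const _)
    rw [← ofReal_integral_eq_lintegral_ofReal hd.integrable_sq
      (Filter.Eventually.of_forall fun _ => sq_nonneg _)]
    refine ENNReal.ofReal_le_ofReal ?_
    rw [← variance_sub_const hfc.aestronglyMeasurable (f x)]
    exact variance_le_expectation_sq hd.1
  have hup : ∫⁻ x, ∫⁻ y, ENNReal.ofReal ((Real.pi / 2 * fderiv ℝ f x y) ^ 2) ∂μ ∂μ ≤
      ENNReal.ofReal ((Real.pi / 2) ^ 2 * ∫ x, V x ∂μ) := by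
    rw [← integral_const_mul, ofReal_integral_eq_lintegral_ofReal (hVi.const_mul _)
      (Filter.Eventually.of_forall fun x => mul_nonneg (sq_nonneg _) (hV0 x))]
    refine lintegral_mono fun x => ?_
    simp_rw [mul_pow]
    rw [← ofReal_integral_eq_lintegral_ofReal ((integrable_dual_sq μ _).const_mul _)
      (Filter.Eventually.of_forall fun _ => by positivity), integral_const_mul]
    exact ENNReal.ofReal_le_ofReal (mul_le_mul_of_nonneg_left (hV x) (sq_nonneg _))
  exact (ENNReal.ofReal_le_ofReal_iff
    (mul_nonneg (sq_nonneg _) (integral_nonneg hV0))).1 (hlow.trans (hmp.trans hup))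

/-- **Gaussian concentration**: upper deviations of a function with bounded Cameron–Martin
gradient from any level that it often stays below. -/
theorem measure_mul_measure_le_exp {E : Type*} [NormedAddCommGroup E] [NormedSpace ℝ E]
    [CompleteSpace E] [SecondCountableTopology E] [MeasurableSpace E] [BorelSpace E]
    {μ : Measure E} [IsGaussian μ] (hμ : μ[id] = 0) {f : E → ℝ} (hf : ContDiff ℝ 1 f)
    {V : ℝ} (hV : ∀ x, ∫ y, (fderiv ℝ f x y) ^ 2 ∂μ ≤ V) (a b l : ℝ) (hl : 0 ≤ l) :
    μ.real {x | f x ≤ a} * μ.real {x | b ≤ f x} ≤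
      Real.exp (l ^ 2 * Real.pi ^ 2 * V / 8 - l * (b - a)) := by
  have hmp := lintegral_convex_sub_le_fderiv hμ hf (Ψ := fun x => Real.exp (l * x))
    (by simpa [Function.comp_def] using
      convexOn_exp.comp_linearMap (l • (LinearMap.id : ℝ →ₗ[ℝ] ℝ))) (by fun_prop)
    (fun x => (Real.exp_pos _).le)
  have hfc := hf.continuous
  have hGc : Continuous fun q : E × E => fderiv ℝ f q.1 q.2 :=
    ((hf.continuous_fderiv one_ne_zero).comp continuous_fst).clm_apply continuous_snd
  have hup : ∫⁻ p, ENNReal.ofReal (Real.exp (l * (Real.pi / 2 * fderiv ℝ f p.1 p.2)))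
      ∂(μ.prod μ) ≤ ENNReal.ofReal (Real.exp (l ^ 2 * Real.pi ^ 2 * V / 8)) := by
    rw [lintegral_prod _ (by fun_prop)]
    -- For fixed `x` the differential is a centered Gaussian in `y`, so its exponential moment is
    -- explicit; `(l π / 2)² / 2` gives `l² π² / 8`.
    calc _ ≤ ∫⁻ _, ENNReal.ofReal (Real.exp (l ^ 2 * Real.pi ^ 2 * V / 8)) ∂μ := by
          refine lintegral_mono fun x => ?_
          have := lintegral_exp_dual_eq hμ ((l * (Real.pi / 2)) • fderiv ℝ f x)
          simp only [FunLike.coe_smul, Pi.smul_apply, smul_eq_mul, mul_pow,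
            integral_const_mul] at this
          simp only [← mul_assoc] at this ⊢
          rw [this]
          refine ENNReal.ofReal_le_ofReal (Real.exp_le_exp.2 ?_)
          have := mul_le_mul_of_nonneg_left (hV x) (sq_nonneg (l * Real.pi))
          nlinarith
      _ = _ := by simp
  -- The product of the two probabilities is the mass of a rectangle on which the increment is at
  -- least `b - a`, so Markov's inequality applies.
  have hsub : {x | f x ≤ a} ×ˢ {x | b ≤ f x} ⊆ {p : E × E |
      ENNReal.ofReal (Real.exp (l * (b - a))) ≤
        ENNReal.ofReal (Real.exp (l * (f p.2 - f p.1)))} := by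
    rintro ⟨x, y⟩ ⟨hx, hy⟩
    refine ENNReal.ofReal_le_ofReal (Real.exp_le_exp.2 (mul_le_mul_of_nonneg_left ?_ hl))
    simp only [Set.mem_ofPred_eq] at hx hy
    simp only
    linarith
  have hmarkov := mul_meas_ge_le_lintegral₀ (μ := μ.prod μ)
    (f := fun p : E × E => ENNReal.ofReal (Real.exp (l * (f p.2 - f p.1))))
    (by fun_prop) (ENNReal.ofReal (Real.exp (l * (b - a))))
  have hall : ENNReal.ofReal (Real.exp (l * (b - a))) * (μ {x | f x ≤ a} * μ {x | b ≤ f x}) ≤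
      ENNReal.ofReal (Real.exp (l ^ 2 * Real.pi ^ 2 * V / 8)) := by
    rw [← Measure.prod_prod]
    exact (mul_le_mul_right (measure_mono hsub) _).trans (hmarkov.trans (hmp.trans hup))
  have hr := ENNReal.toReal_mono ENNReal.ofReal_ne_top hall
  rw [ENNReal.toReal_mul, ENNReal.toReal_mul, ENNReal.toReal_ofReal (Real.exp_pos _).le,
    ENNReal.toReal_ofReal (Real.exp_pos _).le] at hr
  rw [Real.exp_sub, le_div_iff₀ (Real.exp_pos _), mul_comm]
  exact hr

/-! ### Sums of fourth powers of a Gaussian vector. -/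

section GaussianVector

variable {ι : Type*} [Fintype ι] {μ : Measure (ι → ℝ)} [IsGaussian μ]

theorem integrable_coord_pow (μ : Measure (ι → ℝ)) [IsGaussian μ] (a : ι) (k : ℕ) :
    Integrable (fun x => x a ^ k) μ := by
  have h : MemLp (fun x : ι → ℝ => x a) k μ :=
    IsGaussian.memLp_dual μ (ContinuousLinearMap.proj a) k (by simp)
  have hm : Measurable fun x : ι → ℝ => x a ^ k := by fun_prop
  exact (integrable_norm_iff hm.aestronglyMeasurable).1 (by simpa using h.integrable_norm_pow')

theorem integrable_coord_mul (μ : Measure (ι → ℝ)) [IsGaussian μ] (a b : ι) :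
    Integrable (fun x => x a * x b) μ := by
  have h : ∀ a, MemLp (fun x : ι → ℝ => x a) 2 μ := fun a =>
    IsGaussian.memLp_dual μ (ContinuousLinearMap.proj a) 2 (by simp)
  exact (h a).integrable_mul (h b)

theorem integral_coord_even_pow_le (hμ : μ[id] = 0) (a : ι) (k : ℕ) :
    ∫ x, x a ^ (2 * k) ∂μ ≤ 4 * (2 * k).factorial * (∫ x, x a ^ 2 ∂μ) ^ k := by
  set L : StrongDual ℝ (ι → ℝ) := ContinuousLinearMap.proj a
  have h0 : μ[L] = 0 := by
    rw [IsGaussian.integral_dual]; simp only [id] at hμ; simp [hμ]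
  have hmap := IsGaussian.map_eq_gaussianReal (μ := μ) L
  rw [h0, variance_of_integral_eq_zero L.continuous.aemeasurable h0] at hmap
  have := integral_even_pow_gaussianReal_le (∫ x, L x ^ 2 ∂μ).toNNReal k
  rw [← hmap, integral_map L.continuous.aemeasurable (by fun_prop),
    Real.coe_toNNReal _ (integral_nonneg fun x => sq_nonneg _)] at this
  exact this

theorem integral_linear_sq (μ : Measure (ι → ℝ)) [IsGaussian μ] (g : ι → ℝ) :
    ∫ x, (∑ a, g a * x a) ^ 2 ∂μ = ∑ a, ∑ b, g a * g b * ∫ x, x a * x b ∂μ := by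
  have : ∀ x : ι → ℝ, (∑ a, g a * x a) ^ 2 = ∑ a, ∑ b, g a * g b * (x a * x b) := by
    intro x
    rw [sq, Finset.sum_mul_sum]
    exact Finset.sum_congr rfl fun a _ => Finset.sum_congr rfl fun b _ => by ring
  simp_rw [this]
  rw [integral_finsetSum _ fun a _ => integrable_finsetSum _ fun b _ =>
    (integrable_coord_mul μ a b).const_mul _]
  refine Finset.sum_congr rfl fun a _ => ?_
  rw [integral_finsetSum _ fun b _ => (integrable_coord_mul μ a b).const_mul _]
  exact Finset.sum_congr rfl fun b _ => integral_const_mul _ _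

/-- Schur's test: after `2|g_a g_b| ≤ g_a² + g_b²`, symmetry moves all the weight onto one index. -/
theorem sum_mul_symm_le {c : ι → ι → ℝ} {B : ℝ} (hsymm : ∀ a b, c a b = c b a)
    (hB : ∀ a, ∑ b, |c a b| ≤ B) {g : ι → ℝ} (hg : ∀ a, 0 ≤ g a) :
    ∑ a, ∑ b, |c a b| * ((g a + g b) / 2) ≤ B * ∑ a, g a := by
  have h1 : ∑ a, ∑ b, |c a b| * g b = ∑ a, ∑ b, |c a b| * g a := by
    rw [Finset.sum_comm]
    exact Finset.sum_congr rfl fun a _ => Finset.sum_congr rfl fun b _ => by rw [hsymm]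
  have h2 : ∑ a, ∑ b, |c a b| * ((g a + g b) / 2) = ∑ a, ∑ b, |c a b| * g a := by
    have : ∀ a b, |c a b| * ((g a + g b) / 2) = 2⁻¹ * (|c a b| * g a) + 2⁻¹ * (|c a b| * g b) :=
      fun a b => by ring
    simp_rw [this, Finset.sum_add_distrib, ← Finset.mul_sum]
    rw [h1]; ring
  rw [h2, Finset.mul_sum]
  refine Finset.sum_le_sum fun a _ => ?_
  rw [← Finset.sum_mul]
  exact mul_le_mul_of_nonneg_right (hB a) (hg a)

/-- With `v = u_a u_b`, AM-GM gives `|v|³ ≤ (s v⁴ + v² / s) / 2`. The `v⁴` part factorizes and needs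
only the entry bound `A`; the `v²` part is at most `(u_a⁴ + u_b⁴) / 2` and uses the row sums `B`.
The parameter `s` balances the two. -/
theorem quadraticForm_cube_le {c : ι → ι → ℝ} {A B s : ℝ} (hs : 0 < s)
    (hsymm : ∀ a b, c a b = c b a) (hA : ∀ a b, |c a b| ≤ A) (hA0 : 0 ≤ A) (hB0 : 0 ≤ B)
    (hB : ∀ a, ∑ b, |c a b| ≤ B) {u : ι → ℝ} (hu : ∑ a, u a ^ 4 ≤ 1) :
    ∑ a, ∑ b, u a ^ 3 * u b ^ 3 * c a b ≤ (s * A + B / s) / 2 := by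
  have hu0 : 0 ≤ ∑ a, u a ^ 4 := Finset.sum_nonneg fun a _ => by positivity
  have hpt : ∀ a b, u a ^ 3 * u b ^ 3 * c a b ≤ s / 2 * A * (u a ^ 4 * u b ^ 4) +
      s⁻¹ / 2 * (|c a b| * ((u a ^ 4 + u b ^ 4) / 2)) := by
    intro a b
    have h1 : u a ^ 3 * u b ^ 3 ≤ s / 2 * (u a ^ 4 * u b ^ 4) + s⁻¹ / 2 * (u a ^ 2 * u b ^ 2) ∧
        -(u a ^ 3 * u b ^ 3) ≤ s / 2 * (u a ^ 4 * u b ^ 4) + s⁻¹ / 2 * (u a ^ 2 * u b ^ 2) := by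
      have e : ∀ v : ℝ, s / 2 * (v ^ 4) + s⁻¹ / 2 * v ^ 2 - v ^ 3 =
          (s⁻¹ / 2) * (s * v ^ 2 - v) ^ 2 := fun v => by field_simp; ring
      constructor
      · have := e (u a * u b)
        have h : 0 ≤ (s⁻¹ / 2) * (s * (u a * u b) ^ 2 - u a * u b) ^ 2 := by positivity
        simp only [mul_pow] at *
        linarith
      · have := e (-(u a * u b))
        have h : 0 ≤ (s⁻¹ / 2) * (s * (-(u a * u b)) ^ 2 - -(u a * u b)) ^ 2 := by positivity
        rw [← this] at h
        ring_nf at h ⊢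
        linarith
    have h2 : u a ^ 2 * u b ^ 2 ≤ (u a ^ 4 + u b ^ 4) / 2 := by
      nlinarith [sq_nonneg (u a ^ 2 - u b ^ 2)]
    calc u a ^ 3 * u b ^ 3 * c a b ≤ |u a ^ 3 * u b ^ 3| * |c a b| := by
          rw [← abs_mul]; exact le_abs_self _
      _ ≤ (s / 2 * (u a ^ 4 * u b ^ 4) + s⁻¹ / 2 * (u a ^ 2 * u b ^ 2)) * |c a b| := by
          gcongr; exact abs_le'.2 h1
      _ = s / 2 * |c a b| * (u a ^ 4 * u b ^ 4) + s⁻¹ / 2 * (|c a b| * (u a ^ 2 * u b ^ 2)) := by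
          ring
      _ ≤ _ := by
          gcongr
          exact hA a b
  calc _ ≤ ∑ a, ∑ b, (s / 2 * A * (u a ^ 4 * u b ^ 4) +
        s⁻¹ / 2 * (|c a b| * ((u a ^ 4 + u b ^ 4) / 2))) :=
        Finset.sum_le_sum fun a _ => Finset.sum_le_sum fun b _ => hpt a b
    _ = s / 2 * A * ((∑ a, u a ^ 4) * ∑ b, u b ^ 4) +
        s⁻¹ / 2 * ∑ a, ∑ b, |c a b| * ((u a ^ 4 + u b ^ 4) / 2) := by
        simp_rw [Finset.sum_add_distrib, ← Finset.mul_sum, Finset.sum_mul_sum, ← Finset.mul_sum]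
    _ ≤ s / 2 * A * 1 + s⁻¹ / 2 * (B * 1) := by
        gcongr
        · nlinarith
        · exact (sum_mul_symm_le hsymm hB fun a => by positivity).trans (by gcongr)
    _ = _ := by field_simp

theorem contDiff_sum_pow_four : ContDiff ℝ 1 fun x : ι → ℝ => ∑ a, x a ^ 4 := by
  fun_prop

theorem hasFDerivAt_sum_pow_four (x : ι → ℝ) :
    HasFDerivAt (fun x : ι → ℝ => ∑ a, x a ^ 4)
      (∑ a, (4 * x a ^ 3) • (ContinuousLinearMap.proj a : StrongDual ℝ (ι → ℝ))) x := by
  refine HasFDerivAt.fun_sum fun a _ => ?_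
  have := (hasFDerivAt_apply (𝕜 := ℝ) a x).pow 4
  refine this.congr_fderiv ?_
  ext y
  simp

theorem memLp_sum_pow_four (μ : Measure (ι → ℝ)) [IsGaussian μ] :
    MemLp (fun x : ι → ℝ => ∑ a, x a ^ 4) 2 μ := by
  refine memLp_finsetSum _ fun a _ => ?_
  rw [memLp_two_iff_integrable_sq
    (by fun_prop : Measurable fun x : ι → ℝ => x a ^ 4).aestronglyMeasurable]
  simpa only [← pow_mul] using integrable_coord_pow μ a 8

theorem integral_sum_pow_four_le (hμ : μ[id] = 0) {A : ℝ} (hA : ∀ a, ∫ x, x a ^ 2 ∂μ ≤ A) :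
    ∫ x, ∑ a, x a ^ 4 ∂μ ≤ Fintype.card ι * (96 * A ^ 2) := by
  rw [integral_finsetSum _ fun a _ => integrable_coord_pow μ a 4, ← nsmul_eq_mul,
    ← Finset.card_univ, ← Finset.sum_const]
  refine Finset.sum_le_sum fun a _ => (integral_coord_even_pow_le hμ a 2).trans ?_
  have h : (4 * (2 * 2).factorial : ℝ) = 96 := by norm_num [Nat.factorial]
  rw [h]
  gcongr
  exact hA a

theorem variance_sum_pow_four_le (hμ : μ[id] = 0) {A B : ℝ}
    (hA : ∀ a, ∫ x, x a ^ 2 ∂μ ≤ A) (hB : ∀ a, ∑ b, |∫ x, x a * x b ∂μ| ≤ B) (hB0 : 0 ≤ B) :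
    variance (fun x : ι → ℝ => ∑ a, x a ^ 4) μ ≤ 115200 * A ^ 3 * B * Fintype.card ι := by
  set c : ι → ι → ℝ := fun a b => ∫ x, x a * x b ∂μ
  have hi : ∀ a b, Integrable (fun x : ι → ℝ => |c a b| * ((16 * x a ^ 6 + 16 * x b ^ 6) / 2)) μ :=
    fun a b => ((((integrable_coord_pow μ a 6).const_mul 16).add
      ((integrable_coord_pow μ b 6).const_mul 16)).div_const 2).const_mul _
  have hP := variance_le_of_fderiv hμ contDiff_sum_pow_four (memLp_sum_pow_four μ)
    (V := fun x => ∑ a, ∑ b, |c a b| * ((16 * x a ^ 6 + 16 * x b ^ 6) / 2))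
    (integrable_finsetSum _ fun a _ => integrable_finsetSum _ fun b _ => hi a b) (by
      intro x
      rw [(hasFDerivAt_sum_pow_four x).fderiv]
      have := integral_linear_sq μ fun a => 4 * x a ^ 3
      simp only [_root_.sum_apply, FunLike.coe_smul, Pi.smul_apply,
        ContinuousLinearMap.proj_apply, smul_eq_mul]
      rw [this]
      refine Finset.sum_le_sum fun a _ => Finset.sum_le_sum fun b _ => ?_
      refine (le_abs_self _).trans ?_
      rw [abs_mul, mul_comm]
      gcongr
      rw [abs_le]
      constructor <;> nlinarith [sq_nonneg (x a ^ 3 - x b ^ 3), sq_nonneg (x a ^ 3 + x b ^ 3)])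
  have hint : ∫ x, ∑ a, ∑ b, |c a b| * ((16 * x a ^ 6 + 16 * x b ^ 6) / 2) ∂μ =
      ∑ a, ∑ b, |c a b| * ((16 * ∫ x, x a ^ 6 ∂μ) + 16 * ∫ x, x b ^ 6 ∂μ) / 2 := by
    rw [integral_finsetSum _ fun a _ => integrable_finsetSum _ fun b _ => hi a b]
    refine Finset.sum_congr rfl fun a _ => ?_
    rw [integral_finsetSum _ fun b _ => hi a b]
    refine Finset.sum_congr rfl fun b _ => ?_
    rw [integral_const_mul, integral_div, integral_add, integral_const_mul, integral_const_mul,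
      mul_div_assoc]
    · exact (integrable_coord_pow μ a 6).const_mul 16
    · exact (integrable_coord_pow μ b 6).const_mul 16
  have h6 : ∀ a, ∫ x, x a ^ 6 ∂μ ≤ 2880 * A ^ 3 := by
    intro a
    refine (integral_coord_even_pow_le hμ a 3).trans ?_
    have h : (4 * (2 * 3).factorial : ℝ) = 2880 := by norm_num [Nat.factorial]
    rw [h]
    gcongr
    exact hA a
  have hV : ∫ x, ∑ a, ∑ b, |c a b| * ((16 * x a ^ 6 + 16 * x b ^ 6) / 2) ∂μ ≤
      B * (Fintype.card ι * (16 * (2880 * A ^ 3))) := by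
    rw [hint]
    simp_rw [mul_div_assoc]
    refine (sum_mul_symm_le (c := c) (B := B) (fun a b => by simp only [c, mul_comm]) hB
      (g := fun a => 16 * ∫ x, x a ^ 6 ∂μ)
      (fun a => mul_nonneg (by norm_num) (integral_nonneg fun x => by positivity))).trans ?_
    gcongr
    rw [← nsmul_eq_mul, ← Finset.card_univ, ← Finset.sum_const]
    exact Finset.sum_le_sum fun a _ => mul_le_mul_of_nonneg_left (h6 a) (by norm_num)
  have hV0 : 0 ≤ B * (Fintype.card ι * (16 * (2880 * A ^ 3))) :=
    le_trans (integral_nonneg fun x => Finset.sum_nonneg fun a _ => Finset.sum_nonneg fun b _ => by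
      positivity) hV
  -- The final constant is `115200 = 2.5 * 16 * 2880`.
  have hpi : (Real.pi / 2) ^ 2 ≤ 2.5 := by nlinarith [Real.pi_lt_d2, Real.pi_pos]
  calc _ ≤ _ := hP
    _ ≤ (Real.pi / 2) ^ 2 * (B * (Fintype.card ι * (16 * (2880 * A ^ 3)))) := by gcongr
    _ ≤ 2.5 * (B * (Fintype.card ι * (16 * (2880 * A ^ 3)))) := by gcongr
    _ = _ := by ring

/-- The fourth root makes the gradient the cube of a normalized vector with `∑ u_a⁴ ≤ 1`; the added
`1` keeps the function smooth at the origin. -/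
theorem fderiv_one_add_sum_pow_four_rpow (x y : ι → ℝ) :
    fderiv ℝ (fun x : ι → ℝ => (1 + ∑ a, x a ^ 4) ^ (1 / 4 : ℝ)) x y =
      ∑ a, ((1 + ∑ a, x a ^ 4) ^ (-1 / 4 : ℝ) * x a) ^ 3 * y a := by
  have hW : 0 < 1 + ∑ a, x a ^ 4 := by
    have : 0 ≤ ∑ a, x a ^ 4 := Finset.sum_nonneg fun a _ => by positivity
    linarith
  have h := ((hasFDerivAt_sum_pow_four x).const_add 1).rpow_const (p := 1 / 4) (Or.inl hW.ne')
  rw [h.fderiv]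
  have he : (1 + ∑ a, x a ^ 4) ^ (1 / 4 - 1 : ℝ) = ((1 + ∑ a, x a ^ 4) ^ (-1 / 4 : ℝ)) ^ 3 := by
    rw [← Real.rpow_natCast, ← Real.rpow_mul hW.le]; norm_num
  rw [he]
  simp only [FunLike.coe_smul, Pi.smul_apply, _root_.sum_apply,
    ContinuousLinearMap.proj_apply, smul_eq_mul, Finset.mul_sum]
  exact Finset.sum_congr rfl fun a _ => by ring

theorem sum_normalized_pow_four_le (x : ι → ℝ) :
    ∑ a, ((1 + ∑ a, x a ^ 4) ^ (-1 / 4 : ℝ) * x a) ^ 4 ≤ 1 := by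
  have h0 : 0 ≤ ∑ a, x a ^ 4 := Finset.sum_nonneg fun a _ => by positivity
  have hW : 0 < 1 + ∑ a, x a ^ 4 := by linarith
  have he : ((1 + ∑ a, x a ^ 4) ^ (-1 / 4 : ℝ)) ^ 4 = (1 + ∑ a, x a ^ 4)⁻¹ := by
    rw [← Real.rpow_natCast, ← Real.rpow_mul hW.le, ← Real.rpow_neg_one]; norm_num
  simp_rw [mul_pow, he]
  rw [← Finset.mul_sum, inv_mul_le_iff₀ hW]
  linarith

/-- By Markov, `W` stays below twice its mean bound with probability at least `1/2`, so `K` plays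
the role of a median and costs the factor `2`. -/
theorem measure_sum_pow_four_gt_le (hμ : μ[id] = 0) {A B K T s l : ℝ}
    (hA : ∀ a b, |∫ x, x a * x b ∂μ| ≤ A) (hB : ∀ a, ∑ b, |∫ x, x a * x b ∂μ| ≤ B)
    (hA0 : 0 ≤ A) (hB0 : 0 ≤ B) (hs : 0 < s) (hl : 0 ≤ l) (hK0 : 0 < K) (hT : 0 ≤ T)
    (hK : ∫ x, ∑ a, x a ^ 4 ∂μ ≤ K / 2) :
    μ.real {x | T < ∑ a, x a ^ 4} ≤
      2 * Real.exp (l ^ 2 * Real.pi ^ 2 * ((s * A + B / s) / 2) / 8 -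
        l * ((1 + T) ^ (1 / 4 : ℝ) - (1 + K) ^ (1 / 4 : ℝ))) := by
  have hW : ∀ x : ι → ℝ, 0 ≤ ∑ a, x a ^ 4 := fun x =>
    Finset.sum_nonneg fun a _ => by positivity
  have hf : ContDiff ℝ 1 fun x : ι → ℝ => (1 + ∑ a, x a ^ 4) ^ (1 / 4 : ℝ) :=
    (contDiff_const.add contDiff_sum_pow_four).rpow_const_of_ne fun x => by
      have := hW x; positivity
  have hmain := measure_mul_measure_le_exp hμ hf (V := (s * A + B / s) / 2) (by
    intro x
    simp_rw [fderiv_one_add_sum_pow_four_rpow]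
    rw [integral_linear_sq]
    exact quadraticForm_cube_le hs (fun a b => by simp only [mul_comm]) hA hA0 hB0 hB
      (sum_normalized_pow_four_le x)) ((1 + K) ^ (1 / 4 : ℝ)) ((1 + T) ^ (1 / 4 : ℝ)) l hl
  have hmarkov := mul_meas_ge_le_integral_of_nonneg (μ := μ) (Filter.Eventually.of_forall hW)
    ((memLp_sum_pow_four μ).integrable one_le_two) K
  have hhalf : 1 / 2 ≤ μ.real {x : ι → ℝ | (1 + ∑ a, x a ^ 4) ^ (1 / 4 : ℝ) ≤
      (1 + K) ^ (1 / 4 : ℝ)} := by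
    have h1 : μ.real {x : ι → ℝ | K ≤ ∑ a, x a ^ 4} ≤ 1 / 2 := by
      have := hmarkov.trans hK
      rw [mul_comm, ← le_div_iff₀ hK0] at this
      refine this.trans (le_of_eq ?_)
      field_simp
    have h2 : (Set.univ : Set (ι → ℝ)) ⊆ {x | (1 + ∑ a, x a ^ 4) ^ (1 / 4 : ℝ) ≤
        (1 + K) ^ (1 / 4 : ℝ)} ∪ {x | K ≤ ∑ a, x a ^ 4} := by
      intro x _
      rcases le_total K (∑ a, x a ^ 4) with h | h
      · exact Or.inr h
      · left
        have := hW x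
        exact Real.rpow_le_rpow (by linarith) (by linarith) (by norm_num)
    have h3 := (measureReal_mono (μ := μ) h2).trans (measureReal_union_le _ _)
    rw [probReal_univ] at h3
    linarith
  have hsub : μ.real {x : ι → ℝ | T < ∑ a, x a ^ 4} ≤
      μ.real {x : ι → ℝ | (1 + T) ^ (1 / 4 : ℝ) ≤ (1 + ∑ a, x a ^ 4) ^ (1 / 4 : ℝ)} := by
    refine measureReal_mono fun x hx => ?_
    have hx' : T < ∑ a, x a ^ 4 := hx
    exact Real.rpow_le_rpow (by linarith) (by linarith) (by norm_num)
  have := mul_le_mul_of_nonneg_right hhalf (measureReal_nonneg (μ := μ)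
    (s := {x : ι → ℝ | (1 + T) ^ (1 / 4 : ℝ) ≤ (1 + ∑ a, x a ^ 4) ^ (1 / 4 : ℝ)}))
  linarith [this.trans hmain]

end GaussianVector

/-! ### Application to weakly correlated arrays. -/

/-- The entries sharing a row or column contribute at most `N · θ / N`, and the weak covariances at
most `N² · θ / N²`. -/
theorem sum_abs_le_of_weakly_correlated {m n : ℕ} {θ : ℝ} (hθ : 0 ≤ θ)
    (hN : 0 < (m : ℝ) + n) {c : Fin m × Fin n → Fin m × Fin n → ℝ}
    (hc : ∀ a b, |c a b| ≤ θ / ((m : ℝ) + n))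
    (hc' : ∀ a b, a.1 ≠ b.1 → a.2 ≠ b.2 → |c a b| ≤ θ / ((m : ℝ) + n) ^ 2) (a : Fin m × Fin n) :
    ∑ b, |c a b| ≤ 2 * θ := by
  set N : ℝ := (m : ℝ) + n
  have hpt : ∀ b, |c a b| ≤ (if a.1 = b.1 then θ / N else 0) + (if a.2 = b.2 then θ / N else 0) +
      θ / N ^ 2 := by
    intro b
    have h1 : 0 ≤ θ / N := by positivity
    have h2 : 0 ≤ θ / N ^ 2 := by positivity
    have h3 := hc a b
    split_ifs with e1 e2 e2
    · linarith
    · linarith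
    · linarith
    · linarith [hc' a b e1 e2]
  have hmn : (m : ℝ) * n ≤ N ^ 2 := by
    have := mul_nonneg (Nat.cast_nonneg (α := ℝ) m) (Nat.cast_nonneg (α := ℝ) n)
    nlinarith [sq_nonneg ((m : ℝ)), sq_nonneg (n : ℝ)]
  calc ∑ b, |c a b| ≤ ∑ b : Fin m × Fin n, ((if a.1 = b.1 then θ / N else 0) +
        (if a.2 = b.2 then θ / N else 0) + θ / N ^ 2) := Finset.sum_le_sum fun b _ => hpt b
    _ = n * (θ / N) + m * (θ / N) + m * n * (θ / N ^ 2) := by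
        have h1 : ∑ b : Fin m × Fin n, (if a.1 = b.1 then θ / N else 0) = n * (θ / N) := by
          rw [Fintype.sum_prod_type_right]; simp
        have h2 : ∑ b : Fin m × Fin n, (if a.2 = b.2 then θ / N else 0) = m * (θ / N) := by
          rw [Fintype.sum_prod_type]; simp
        rw [Finset.sum_add_distrib, Finset.sum_add_distrib, h1, h2]
        simp
    _ = N * (θ / N) + (m * n) * (θ / N ^ 2) := by simp only [N]; ring
    _ ≤ N * (θ / N) + N ^ 2 * (θ / N ^ 2) := by gcongr
    _ = 2 * θ := by field_simp; ring

/-- Both `x^(1/5)` and the constant `log 2 + C` are `o(x^(1/4))`. -/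
theorem exists_two_mul_exp_le_exp_neg_rpow (C : ℝ) {d : ℝ} (hd : 0 < d) :
    ∃ x₀ : ℝ, 0 < x₀ ∧ ∀ x ≥ x₀,
      2 * Real.exp (C - x ^ (1 / 4 : ℝ) * d) ≤ Real.exp (-x ^ (1 / 5 : ℝ)) := by
  have h1 : (fun x : ℝ => x ^ (1 / 5 : ℝ)) =o[Filter.atTop] fun x : ℝ => x ^ (1 / 4 : ℝ) := by
    refine (Asymptotics.isLittleO_iff_tendsto' ?_).2 ?_
    · filter_upwards [Filter.eventually_gt_atTop 0] with x hx h
      exact absurd h (Real.rpow_pos_of_pos hx _).ne'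
    · refine (tendsto_rpow_neg_atTop (by norm_num : (0 : ℝ) < 1 / 20)).congr' ?_
      filter_upwards [Filter.eventually_gt_atTop 0] with x hx
      rw [← Real.rpow_sub hx]
      norm_num
  have h2 : (fun _ : ℝ => Real.log 2 + C) =o[Filter.atTop] fun x : ℝ => x ^ (1 / 4 : ℝ) :=
    Asymptotics.isLittleO_const_left.2 (Or.inr
      (Filter.tendsto_abs_atTop_atTop.comp (tendsto_rpow_atTop (by norm_num))))
  obtain ⟨x₁, hx₁⟩ := Filter.eventually_atTop.1 ((h1.add h2).bound hd)
  refine ⟨max x₁ 1, by positivity, fun x hx => ?_⟩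
  have hx0 : 0 ≤ x := zero_le_one.trans ((le_max_right _ _).trans hx)
  have h := (le_abs_self _).trans (hx₁ x ((le_max_left _ _).trans hx))
  rw [Real.norm_of_nonneg (Real.rpow_nonneg hx0 _)] at h
  calc 2 * Real.exp (C - x ^ (1 / 4 : ℝ) * d)
      = Real.exp (Real.log 2 + (C - x ^ (1 / 4 : ℝ) * d)) := by
        rw [Real.exp_add, Real.exp_log two_pos]
    _ ≤ _ := Real.exp_le_exp.2 (by linarith)

theorem abs_integral_mul_le_of_sq {Ω : Type*} [MeasurableSpace Ω] {P : Measure Ω}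
    {X Y : Ω → ℝ} (hX : MemLp X 2 P) (hY : MemLp Y 2 P) {A : ℝ}
    (hXA : ∫ ω, X ω ^ 2 ∂P ≤ A) (hYA : ∫ ω, Y ω ^ 2 ∂P ≤ A) : |∫ ω, X ω * Y ω ∂P| ≤ A := by
  have hi : Integrable (fun ω => (X ω ^ 2 + Y ω ^ 2) / 2) P :=
    (hX.integrable_sq.add hY.integrable_sq).div_const 2
  calc |∫ ω, X ω * Y ω ∂P| ≤ ∫ ω, (X ω ^ 2 + Y ω ^ 2) / 2 ∂P := by
        rw [← Real.norm_eq_abs]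
        refine norm_integral_le_of_norm_le hi (Filter.Eventually.of_forall fun ω => ?_)
        rw [Real.norm_eq_abs, abs_le]
        constructor <;> nlinarith [sq_nonneg (X ω - Y ω), sq_nonneg (X ω + Y ω)]
    _ = (∫ ω, X ω ^ 2 ∂P + ∫ ω, Y ω ^ 2 ∂P) / 2 := by
        rw [integral_div, integral_add hX.integrable_sq hY.integrable_sq]
    _ ≤ A := by linarith

theorem IsWeaklyCorrelatedGaussianArray.quarticSum_bounds {Ω : Type*} [MeasurableSpace Ω]
    {m n : ℕ} {w : Fin m → Fin n → Ω → ℝ} {θ : ℝ} {P : Measure Ω} (hθ : 0 < θ)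
    (hN : 0 < (m : ℝ) + n) (h : IsWeaklyCorrelatedGaussianArray w θ P) :
    MemLp (quarticSum w) 2 P ∧ ∫ ω, quarticSum w ω ∂P ≤ 24 * θ ^ 2 ∧
      variance (quarticSum w) P ≤ 57600 * θ ^ 4 / ((m : ℝ) + n) ∧
      ∀ T : ℝ, 0 ≤ T → P.real {ω | T < quarticSum w ω} ≤
        2 * Real.exp (3 * θ * Real.pi ^ 2 / 16 - ((m : ℝ) + n) ^ (1 / 4 : ℝ) *
          ((1 + T) ^ (1 / 4 : ℝ) - (1 + 48 * θ ^ 2) ^ (1 / 4 : ℝ))) := by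
  set X : Ω → Fin m × Fin n → ℝ := fun ω p => w p.1 p.2 ω with hXdef
  set N : ℝ := (m : ℝ) + n
  have hX : AEMeasurable X P := h.gaussian.aemeasurable
  set μ : Measure (Fin m × Fin n → ℝ) := P.map X
  have hG : IsGaussian μ := h.gaussian.isGaussian_map
  have hcov : ∀ a b, ∫ x, x a * x b ∂μ = ∫ ω, w a.1 a.2 ω * w b.1 b.2 ω ∂P := fun a b =>
    integral_map hX (by fun_prop)
  have hsq : ∀ a, ∫ x, x a ^ 2 ∂μ ≤ θ / N := fun a => by
    have : ∫ x, x a ^ 2 ∂μ = ∫ ω, w a.1 a.2 ω ^ 2 ∂P :=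
      integral_map hX (by fun_prop : Measurable fun x : _ → ℝ => x a ^ 2).aestronglyMeasurable
    rw [this]
    exact h.second_moment_le _ _
  have hμ : μ[id] = 0 := by
    ext a
    have h1 := (ContinuousLinearMap.proj (R := ℝ) (φ := fun _ : Fin m × Fin n => ℝ)
      a).integral_comp_comm (IsGaussian.integrable_id (μ := μ))
    have h2 : ∫ x, x a ∂μ = ∫ ω, w a.1 a.2 ω ∂P :=
      integral_map hX (by fun_prop : Measurable fun x : _ → ℝ => x a).aestronglyMeasurable
    rw [h.centered] at h2
    exact h1.symm.trans h2
  have hL2 : ∀ a, MemLp (fun x : Fin m × Fin n → ℝ => x a) 2 μ := fun a =>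
    IsGaussian.memLp_dual μ (ContinuousLinearMap.proj a) 2 (by simp)
  have hA : ∀ a b, |∫ x, x a * x b ∂μ| ≤ θ / N := fun a b =>
    abs_integral_mul_le_of_sq (hL2 a) (hL2 b) (hsq a) (hsq b)
  have hB : ∀ a, ∑ b, |∫ x, x a * x b ∂μ| ≤ 2 * θ :=
    sum_abs_le_of_weakly_correlated hθ.le hN hA fun a b h1 h2 => by
      rw [hcov]
      exact h.abs_cov_le _ _ _ _ h1 h2
  have hcard : (Fintype.card (Fin m × Fin n) : ℝ) ≤ N ^ 2 / 4 := by
    simp only [Fintype.card_prod, Fintype.card_fin, Nat.cast_mul, N]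
    nlinarith [sq_nonneg ((m : ℝ) - n)]
  have hq : quarticSum w = (fun x : Fin m × Fin n → ℝ => ∑ a, x a ^ 4) ∘ X := by
    ext ω
    simp [quarticSum, hXdef, Fintype.sum_prod_type]
  have hWc : Continuous fun x : Fin m × Fin n → ℝ => ∑ a, x a ^ 4 := by fun_prop
  have hmean : ∫ x, ∑ a, x a ^ 4 ∂μ ≤ 24 * θ ^ 2 := by
    refine (integral_sum_pow_four_le hμ hsq).trans ?_
    calc _ ≤ N ^ 2 / 4 * (96 * (θ / N) ^ 2) := by gcongr
      _ = _ := by field_simp; ring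
  refine ⟨?_, ?_, ?_, fun T hT => ?_⟩
  · rw [hq]
    exact (memLp_map_measure_iff hWc.aestronglyMeasurable hX).1 (memLp_sum_pow_four μ)
  · rw [hq]
    exact (integral_map hX hWc.aestronglyMeasurable).symm.trans_le hmean
  · rw [hq, ← variance_map hWc.aemeasurable hX]
    refine (variance_sum_pow_four_le hμ hsq hB (by positivity)).trans ?_
    calc _ ≤ 115200 * (θ / N) ^ 3 * (2 * θ) * (N ^ 2 / 4) := by gcongr
      _ = _ := by field_simp; ring
  · have hset : P.real {ω | T < quarticSum w ω} = μ.real {x | T < ∑ a, x a ^ 4} := by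
      rw [measureReal_def, measureReal_def, Measure.map_apply_of_aemeasurable hX
        (measurableSet_lt measurable_const hWc.measurable), hq]
      rfl
    rw [hset]
    -- Here `s = √N` balances `s A` with `B / s`, and `l = N^(1/4)` keeps the quadratic term of the
    -- exponent independent of `N`. The level `48 θ²` is twice the mean bound.
    refine (measure_sum_pow_four_gt_le hμ hA hB (by positivity) (by positivity)
      (Real.sqrt_pos.2 hN) (Real.rpow_nonneg hN.le (1 / 4)) (by positivity : 0 < 48 * θ ^ 2) hT
      (by linarith)).trans (le_of_eq ?_)
    congr 3
    have h1 : (N ^ (1 / 4 : ℝ)) ^ 2 = √N := by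
      rw [Real.sqrt_eq_rpow, ← Real.rpow_natCast, ← Real.rpow_mul hN.le]; norm_num
    have h2 : √N * √N = N := Real.mul_self_sqrt hN.le
    have h3 : √N * (√N * (θ / N) + 2 * θ / √N) = 3 * θ := by
      have h4 := (Real.sqrt_pos.2 hN).ne'
      rw [mul_add, ← mul_assoc, h2, mul_div_cancel₀ _ h4, mul_div_cancel₀ _ hN.ne']
      ring
    rw [h1]
    linear_combination Real.pi ^ 2 / 16 * h3

theorem theorem5p1 :
    ∃ γ : ℝ, 0 < γ ∧ ∀ θ : ℝ, 0 < θ → ∃ γ₁ : ℝ, 0 < γ₁ ∧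
      ∀ (m n : ℕ) (Ω : Type*) [MeasurableSpace Ω] (P : Measure Ω) [IsProbabilityMeasure P]
        (w : Fin m → Fin n → Ω → ℝ), IsWeaklyCorrelatedGaussianArray w θ P →
        MemLp (quarticSum w) 2 P ∧
        ∫ ω, quarticSum w ω ∂P ≤ γ * θ ^ 2 ∧
        variance (quarticSum w) P ≤ γ * θ ^ 4 / ((m : ℝ) + n) ∧
        (γ₁ ≤ (m : ℝ) + n →
          P.real {ω | γ * θ ^ 2 + 1 < quarticSum w ω} ≤
            Real.exp (-((m : ℝ) + n) ^ (1 / 5 : ℝ))) := by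
  -- The variance constant; it also exceeds `24` for the mean and `48` for the median level, which
  -- makes the gap `hd` positive.
  refine ⟨57600, by norm_num, fun θ hθ => ?_⟩
  have hd : 0 < (1 + (57600 * θ ^ 2 + 1)) ^ (1 / 4 : ℝ) - (1 + 48 * θ ^ 2) ^ (1 / 4 : ℝ) :=
    sub_pos.2 (Real.rpow_lt_rpow (by positivity) (by nlinarith [sq_nonneg θ]) (by norm_num))
  obtain ⟨γ₁, hγ₁, hlarge⟩ := exists_two_mul_exp_le_exp_neg_rpow (3 * θ * Real.pi ^ 2 / 16) hd
  refine ⟨γ₁, hγ₁, fun m n Ω _ P _ w hw => ?_⟩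
  -- If `m + n = 0` the array is empty and `W = 0`; division by zero makes the variance bound `0`,
  -- and `γ₁ > 0` makes the tail claim vacuous.
  rcases (by positivity : (0 : ℝ) ≤ (m : ℝ) + n).eq_or_lt with hN | hN
  · have hm : m = 0 := by
      have : ((m + n : ℕ) : ℝ) = 0 := by push_cast; exact hN.symm
      have := Nat.cast_eq_zero.1 this
      omega
    subst hm
    have h0 : quarticSum w = fun _ => 0 := by ext ω; simp [quarticSum]
    refine ⟨by simp [h0], by simp [h0]; positivity, ?_, fun h => absurd h (by linarith)⟩
    rw [← hN, h0, div_zero]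
    exact (variance_zero P).le
  · obtain ⟨h1, h2, h3, h4⟩ := hw.quarticSum_bounds hθ hN
    refine ⟨h1, h2.trans (by gcongr; norm_num), h3, fun h => ?_⟩
    exact (h4 _ (by positivity)).trans (hlarge _ h)
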